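/- Let $r\ge 3$ and $n_r=2^r-1$. Let $h(x)=1+x^a+x^b\in\mathbb F_2[x]$ with $0<a<b<n_r$ be such that $\gcd(h(x),x^{n_r}-1)$ is a primitive polynomial of degree $r$, and let $H\in M_{n_r}(\mathbb F_2)$ be the cyclic matrix whose $i$-th row ($0\le i<n_r$) is the coefficient vector of $x^ih(x)\bmod (x^{n_r}-1)$, so that $\ker H$ is the simplex code of dimension $r$. Let $G\in\mathbb F_2^{r\times n_r}$ be a matrix whose rows span $\ker H$, and let $P\in\mathbb F_2^{r\times n_r}$ be a pivot matrix for $G$: every row of $P$ is a standard basis vector, and $PG^T=I_r$. The code $SHYPS(r)$ is the CSS subsystem code on $n_r\times n_r$ physical qubits whose gauge group is generated by $i$, by the operators $X^u$ with $u$ a row of $G_X=H\otimes I_{n_r}$, and by the operators $Z^v$ with $v$ a row of $G_Z=I_{n_r}\otimes H$. Its stabilizers are the $X^u$ with $u\in\mathrm{RowSpace}(G_X)$ orthogonal to $\mathrm{RowSpace}(G_Z)$ and the $Z^v$ with $v\in\mathrm{RowSpace}(G_Z)$ orthogonal to $\mathrm{RowSpace}(G_X)$, and the code space is their common $+1$ eigenspace.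 It has $r\times r$ logical qubits, with logical Pauli operators $\overline X_{i,j}$, $\overline Z_{i,j}$ given by the rows with index $(i,j)$ of $L_X=P\otimes G$ and $L_Z=G\otimes P$. For $V\in M_r(\mathbb F_2)$ let $H^V=\prod_{(i,j):V_{i,j}=1}H_{(i,j)}$ be the circuit on the $r\times r$ logical qubits that applies a Hadamard gate to each qubit $(i,j)$ with $V_{i,j}=1$. Theorem. For every $V\in M_r(\mathbb F_2)$, the logical Hadamard circuit $H^V$ on $SHYPS(r)$ is implemented, up to a logical Pauli correction, by a physical circuit of depth at most $11r+15$. That is, there are a physical circuit on the $n_r^2$ qubits of the code, consisting of at most $11r+15$ layers, each a product of gates from $H$, $S$, $HSH$, $\mathrm{CNOT}$, $\mathrm{CZ}$, $(H\otimes H)\,\mathrm{CZ}\,(H\otimes H)$ acting on pairwise disjoint sets of qubits, with total unitary $U$, and a logical Pauli operator $Q=X^{\alpha L_X}Z^{\beta L_Z}$, such that $W=QU$ maps the gauge group into itself under conjugation, preserves the code space, and acts on the logical qubits as $H^V$: on the code space, $W$ transforms the logical Pauli operators (including their signs) exactly as $H^V$ transforms the corresponding Pauli operators of the logical qubits. 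-/

import Mathlib

open scoped Kronecker Matrix

namespace SHYPS

noncomputable section

/-! ## Qubits, Pauli operators, Clifford gates and circuits

The qubits are labelled by a finite type `Q`. Computational basis states are the
bit strings `Q → ZMod 2`, and operators are complex matrices indexed by them. -/

section Circuits

variable {Q : Type} [Fintype Q] [DecidableEq Q]

/-- Operators on the Hilbert space of the qubits `Q`. -/
abbrev Op (Q : Type) : Type := Matrix (Q → ZMod 2) (Q → ZMod 2) ℂ

/-- The sign `(-1)^s` of a bit `s`. -/
def sgn (s : ZMod 2) : ℂ := (-1) ^ s.val

/-- The Pauli operator `X^u Z^v`, i.e. `|x⟩ ↦ (-1)^(v·x) |x + u⟩`. -/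
def pauli (u v : Q → ZMod 2) : Op Q :=
  Matrix.of fun y x => if y = x + u then sgn (v ⬝ᵥ x) else 0

/-- The Hadamard circuit `H^v = ∏ H_q^(v_q)`: the tensor product over all qubits `q` of the
`2 × 2` Hadamard matrix `((-1)^(yx) / √2)` if `v q = 1`, and of the identity otherwise. -/
def hadamard (v : Q → ZMod 2) : Op Q :=
  Matrix.of fun y x => ∏ q,
    if v q = 1 then sgn (y q * x q) / (Real.sqrt 2 : ℂ) else if y q = x q then 1 else 0

/-- The physical gates: the one-qubit gates `H`, `S`, `√X = H S H`, and the two-qubit gates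
`CNOT`, `CZ` and `(H ⊗ H) CZ (H ⊗ H)`. -/
inductive Gate (Q : Type) : Type
  | h (q : Q) : Gate Q
  | s (q : Q) : Gate Q
  | sx (q : Q) : Gate Q
  | cnot (c t : Q) (hct : c ≠ t) : Gate Q
  | cz (p q : Q) (hpq : p ≠ q) : Gate Q
  | xcx (p q : Q) (hpq : p ≠ q) : Gate Q

/-- The phase gate `S = diag(1, i)` on the qubit `q`. -/
def phaseOp (q : Q) : Op Q := Matrix.diagonal fun x => Complex.I ^ (x q).val

/-- The gate `CNOT` with control `c` and target `t`. -/
def cnotOp (c t : Q) : Op Q :=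
  Matrix.of fun y x => if y = Function.update x t (x t + x c) then 1 else 0

/-- The controlled-`Z` gate on the qubits `p`, `q`. -/
def czOp (p q : Q) : Op Q := Matrix.diagonal fun x => sgn (x p * x q)

/-- The unitary performed by a gate. -/
def Gate.op : Gate Q → Op Q
  | .h q => hadamard (Pi.single q 1)
  | .s q => phaseOp q
  | .sx q => hadamard (Pi.single q 1) * phaseOp q * hadamard (Pi.single q 1)
  | .cnot c t _ => cnotOp c t
  | .cz p q _ => czOp p q
  | .xcx p q _ =>
      hadamard (Pi.single p 1 + Pi.single q 1) * czOp p q *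
        hadamard (Pi.single p 1 + Pi.single q 1)

/-- The qubits on which a gate acts. -/
def Gate.support : Gate Q → Finset Q
  | .h q => {q}
  | .s q => {q}
  | .sx q => {q}
  | .cnot c t _ => {c, t}
  | .cz p q _ => {p, q}
  | .xcx p q _ => {p, q}

/-- A depth-one circuit: finitely many gates that act on pairwise disjoint sets of qubits. -/
structure Layer (Q : Type) [DecidableEq Q] : Type where
  gates : List (Gate Q)
  disjoint : gates.Pairwise fun g g' => Disjoint g.support g'.support

/-- The unitary performed by a depth-one circuit. -/
def Layer.op (L : Layer Q) : Op Q := (L.gates.map Gate.op).prod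

/-- A circuit is a sequence of depth-one circuits, the head of the list being applied first. -/
abbrev Circuit (Q : Type) [DecidableEq Q] : Type := List (Layer Q)

/-- The depth of a circuit is its number of layers. -/
def Circuit.depth (C : Circuit Q) : ℕ := List.length C

/-- The unitary performed by a circuit. -/
def Circuit.op : Circuit Q → Op Q
  | [] => 1
  | L :: C => Circuit.op C * L.op

end Circuits

/-! ## CSS subsystem codes -/

/-- A CSS subsystem code on the physical qubits `Q` with a chosen basis of logical Pauli operators
for the logical qubits `K`. The rows of `GX`, `GZ` give the gauge generators of `X`- and `Z`-type,
and the rows of `LX`, `LZ` the logical `X` and `Z` operators. -/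
structure SubsystemCode (Q K : Type) : Type 1 where
  ιX : Type
  ιZ : Type
  GX : Matrix ιX Q (ZMod 2)
  GZ : Matrix ιZ Q (ZMod 2)
  LX : Matrix K Q (ZMod 2)
  LZ : Matrix K Q (ZMod 2)

namespace SubsystemCode

variable {Q K : Type} [Fintype Q] [DecidableEq Q] [Fintype K] [DecidableEq K]
  (𝒞 : SubsystemCode Q K)

/-- The `X`-type gauge operators, as a space of bit vectors. -/
def gaugeX : Submodule (ZMod 2) (Q → ZMod 2) := Submodule.span (ZMod 2) (Set.range 𝒞.GX.row)

/-- The `Z`-type gauge operators, as a space of bit vectors. -/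
def gaugeZ : Submodule (ZMod 2) (Q → ZMod 2) := Submodule.span (ZMod 2) (Set.range 𝒞.GZ.row)

/-- The gauge group, generated by `i` and the gauge generators of both types. -/
def gaugeGroup : Set (Op Q) :=
  {g | ∃ k : ℕ, ∃ u ∈ 𝒞.gaugeX, ∃ v ∈ 𝒞.gaugeZ, g = Complex.I ^ k • pauli u v}

/-- The code space: the common `+1` eigenspace of the stabilizers. The stabilizer group is the
centre of the gauge group modulo phases; it is generated by the `X^u` with `u` an `X`-type gauge
vector orthogonal to all `Z`-type gauge vectors, and by the `Z^v` with `v` a `Z`-type gauge vector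
orthogonal to all `X`-type gauge vectors. -/
def codeSpace : Set ((Q → ZMod 2) → ℂ) :=
  {ψ | (∀ u ∈ 𝒞.gaugeX, (∀ w ∈ 𝒞.gaugeZ, u ⬝ᵥ w = 0) → pauli u 0 *ᵥ ψ = ψ) ∧
    (∀ v ∈ 𝒞.gaugeZ, (∀ w ∈ 𝒞.gaugeX, w ⬝ᵥ v = 0) → pauli 0 v *ᵥ ψ = ψ)}

/-- The encoded version of the Pauli operator `X^a Z^b` on the logical qubits. -/
def logicalPauli (a b : K → ZMod 2) : Op Q := pauli (a ᵥ* 𝒞.LX) (b ᵥ* 𝒞.LZ)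

/-- The physical operator `W` implements the Clifford operator `g` on the logical qubits:
it normalizes the gauge group, preserves the code space, and on the code space it transforms the
encoded Pauli operators (with their phases) in the way in which `g` transforms the Pauli operators
of the logical qubits. Equivalently, on the code space, `W` is `g` on the logical qubits tensored
with some operator on the gauge qubits. -/
structure Implements (W : Op Q) (g : Op K) : Prop where
  gauge : ∀ x ∈ 𝒞.gaugeGroup, ∃ y ∈ 𝒞.gaugeGroup, W * x = y * W
  code : ∀ ψ ∈ 𝒞.codeSpace, W *ᵥ ψ ∈ 𝒞.codeSpace
  logical : ∀ (a b a' b' : K → ZMod 2) (c : ℂ), g * pauli a b = c • (pauli a' b' * g) →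
    ∀ ψ ∈ 𝒞.codeSpace,
      W *ᵥ (𝒞.logicalPauli a b *ᵥ ψ) = c • (𝒞.logicalPauli a' b' *ᵥ (W *ᵥ ψ))

end SubsystemCode

/-! ## Simplex codes and the codes `SHYPS(r)` -/

/-- The length `n_r = 2^r - 1` of the simplex code. -/
abbrev len (r : ℕ) : ℕ := 2 ^ r - 1

/-- The trinomial `1 + x^a + x^b` over the field with two elements. -/
def trinomial (a b : ℕ) : Polynomial (ZMod 2) := 1 + Polynomial.X ^ a + Polynomial.X ^ b

/-- A primitive polynomial of degree `r` over the field with two elements: it is irreducible and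
its root generates the multiplicative group of the field with `2^r` elements. -/
def IsPrimitivePoly (r : ℕ) (p : Polynomial (ZMod 2)) : Prop :=
  Irreducible p ∧ p.natDegree = r ∧ orderOf (AdjoinRoot.root p) = 2 ^ r - 1

open Classical in
/-- `h = 1 + x^a + x^b` is a parity check polynomial of the simplex code of dimension `r`. -/
def IsCheckTrinomial (r a b : ℕ) : Prop :=
  0 < a ∧ a < b ∧ b < len r ∧
    IsPrimitivePoly r (EuclideanDomain.gcd (trinomial a b) (Polynomial.X ^ len r - 1))

/-- The cyclic parity check matrix whose `i`-th row is `x^i h(x)` modulo `x^(n_r) - 1`. -/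
def parityCheck (r a b : ℕ) : Matrix (Fin (len r)) (Fin (len r)) (ZMod 2) :=
  Matrix.of fun i j => (trinomial a b).coeff (j - i : Fin (len r)).val

/-- The pivot matrix of a list of bit indices. -/
def pivotMatrix {r : ℕ} (π : Fin r → Fin (len r)) : Matrix (Fin r) (Fin (len r)) (ZMod 2) :=
  Matrix.of fun i j => if π i = j then 1 else 0

/-- `G` is a generator matrix of the code with parity check matrix `H`, with pivots `π`: its rows
span `ker H` and `P Gᵀ = I` for the pivot matrix `P`. -/
structure IsPivotedGenerator {r : ℕ} (H : Matrix (Fin (len r)) (Fin (len r)) (ZMod 2))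
    (G : Matrix (Fin r) (Fin (len r)) (ZMod 2)) (π : Fin r → Fin (len r)) : Prop where
  span_rows : Submodule.span (ZMod 2) (Set.range G.row) = LinearMap.ker H.mulVecLin
  pivots : pivotMatrix π * Gᵀ = 1

/-- The code `SHYPS(r)` with `n_r × n_r` physical and `r × r` logical qubits: gauge generators
`G_X = H ⊗ I`, `G_Z = I ⊗ H` and logical operators `L_X = P ⊗ G`, `L_Z = G ⊗ P`. -/
def shyps {r : ℕ} (H : Matrix (Fin (len r)) (Fin (len r)) (ZMod 2))
    (G : Matrix (Fin r) (Fin (len r)) (ZMod 2)) (π : Fin r → Fin (len r)) :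
    SubsystemCode (Fin (len r) × Fin (len r)) (Fin r × Fin r) where
  ιX := Fin (len r) × Fin (len r)
  ιZ := Fin (len r) × Fin (len r)
  GX := H ⊗ₖ (1 : Matrix (Fin (len r)) (Fin (len r)) (ZMod 2))
  GZ := (1 : Matrix (Fin (len r)) (Fin (len r)) (ZMod 2)) ⊗ₖ H
  LX := pivotMatrix π ⊗ₖ G
  LZ := G ⊗ₖ pivotMatrix π

end

end SHYPS

/-!
The logical Hadamard circuit is performed by decoding the logical qubits onto single physical
qubits, applying Hadamard gates there, and encoding again. Decoding is possible in depth linear in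
`r` because the code has length `2 ^ r - 1`.

The columns of `G` are the nonzero vectors of `𝔽₂ʳ`, each occurring once
(`IsPivotedGenerator.labelling`): the simplex code consists of the words `(φ (α ^ j))_j`, where `α`
is a root of the primitive factor of `h` and `φ` a linear functional, and these words separate the
positions. The positions are therefore the nonzero vectors `q`, the row `G_j` is the `j`-th
coordinate function, and the pivot `π j` is the unit vector `e_j`. The zeta transform
`f ↦ (q ↦ ∑_{q' ≤ q} f q')` over the nonzero vectors, ordered as subsets of the coordinates, is a
product of `r` steps, each of which is one layer of disjoint `CNOT` gates `q → q + e_s`. Modulo 2 it is its own inverse, and it sends `G_j`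
to the indicator function of `π j`, while its contragredient fixes that indicator function.

With the zeta transform along the rows of the grid and its contragredient along the columns
(`PointLabelling.decoder`, of depth `2r`), the logical operators `X̄_{i,j}` and `Z̄_{i,j}`, given by
`P_i ⊗ G_j` and `G_i ⊗ P_j`, become the Pauli operators `X` and `Z` of the physical qubit
`(π i, π j)`; see `PointLabelling.fwdList_decoder` and `PointLabelling.bwdList_decoder`. The gauge
operators commute with these bare logical operators, so after decoding they are trivial on the
qubits `(π i, π j)`, and Hadamard gates there do not disturb them. This is
`SubsystemCode.implements_hadamard`. The resulting circuit has depth `4r + 1`, fixes every gauge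
operator and transforms the logical operators with the right signs, so that the Pauli correction is
trivial.
-/

namespace SHYPS

set_option linter.unusedSectionVars false

/-! ### Tensor products of one-qubit operators -/

section Tensor

variable {Q K : Type} [Fintype Q] [DecidableEq Q] [Fintype K] [DecidableEq K]

/-- The tensor product over all qubits `q` of the one-qubit operators `A q`. -/
def tensorOp (A : Q → Matrix (ZMod 2) (ZMod 2) ℂ) : Op Q :=
  Matrix.of fun y x => ∏ q, A q (y q) (x q)

theorem tensorOp_mul (A B : Q → Matrix (ZMod 2) (ZMod 2) ℂ) :
    tensorOp A * tensorOp B = tensorOp fun q => A q * B q := by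
  ext y x
  simp only [tensorOp, Matrix.mul_apply, Matrix.of_apply, ← Finset.prod_mul_distrib]
  rw [Finset.prod_univ_sum]
  simp

theorem tensorOp_one : tensorOp (fun _ : Q => 1) = 1 := by
  ext y x
  simp [tensorOp, Matrix.one_apply, Finset.prod_ite_zero, funext_iff]

/-- The one-qubit Pauli operator `X^u Z^v`. -/
noncomputable def pauliFactor (u v : ZMod 2) : Matrix (ZMod 2) (ZMod 2) ℂ :=
  Matrix.of fun y x => if y = x + u then sgn (v * x) else 0

/-- The one-qubit factor of a Hadamard circuit: the Hadamard matrix if `v = 1`, else the identity. -/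
noncomputable def hadamardFactor (v : ZMod 2) : Matrix (ZMod 2) (ZMod 2) ℂ :=
  Matrix.of fun y x => if v = 1 then sgn (y * x) / (Real.sqrt 2 : ℂ) else if y = x then 1 else 0

theorem sgn_add (s t : ZMod 2) : sgn (s + t) = sgn s * sgn t := by
  have h : ∀ a b : ZMod 2, (a + b).val = (a.val + b.val) % 2 := by decide
  rw [sgn, sgn, sgn, ← pow_add, h]
  exact (neg_one_pow_eq_pow_mod_two _).symm

theorem sgn_zero : sgn 0 = 1 := by simp [sgn]

theorem sgn_sum {ι : Type*} (s : Finset ι) (f : ι → ZMod 2) :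
    sgn (∑ i ∈ s, f i) = ∏ i ∈ s, sgn (f i) := by
  classical
  induction s using Finset.induction_on with
  | empty => simp [sgn_zero]
  | insert a s ha ih => rw [Finset.sum_insert ha, Finset.prod_insert ha, sgn_add, ih]

theorem pauli_eq_tensorOp (u v : Q → ZMod 2) :
    pauli u v = tensorOp fun q => pauliFactor (u q) (v q) := by
  ext y x
  simp only [pauli, tensorOp, pauliFactor, Matrix.of_apply, dotProduct, sgn_sum,
    Finset.prod_ite_zero, funext_iff, Pi.add_apply, Finset.mem_univ, true_imp_iff]

theorem hadamard_eq_tensorOp (v : Q → ZMod 2) :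
    hadamard v = tensorOp fun q => hadamardFactor (v q) := rfl

theorem pauliFactor_zero : pauliFactor 0 0 = 1 := by
  ext y x
  simp [pauliFactor, Matrix.one_apply, sgn_zero]

theorem hadamardFactor_zero : hadamardFactor 0 = 1 := by
  ext y x
  simp [hadamardFactor, Matrix.one_apply]

theorem pauli_zero : pauli (0 : Q → ZMod 2) 0 = 1 := by
  rw [pauli_eq_tensorOp]
  simp [pauliFactor_zero, tensorOp_one]

/-- Hadamard circuits on disjoint sets of qubits compose to the Hadamard circuit on the union. -/
theorem hadamard_mul_hadamard {v w : Q → ZMod 2} (h : ∀ q, v q = 0 ∨ w q = 0) :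
    hadamard v * hadamard w = hadamard (v + w) := by
  simp only [hadamard_eq_tensorOp, tensorOp_mul]
  congr 1
  funext q
  rcases h q with h | h <;> simp [h, hadamardFactor_zero]

/-- The operator on the qubits `Q` that acts as `M` on the qubits in the range of `pos` and as the
identity on the others. -/
def embedOp (pos : K → Q) (M : Op K) : Op Q :=
  Matrix.of fun y x => if ∀ q, (∀ k, pos k ≠ q) → y q = x q then M (y ∘ pos) (x ∘ pos) else 0

theorem embedOp_smul (pos : K → Q) (c : ℂ) (M : Op K) :
    embedOp pos (c • M) = c • embedOp pos M := by
  ext y x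
  simp [embedOp]

theorem embedOp_tensorOp {pos : K → Q} (hpos : Function.Injective pos)
    (A : K → Matrix (ZMod 2) (ZMod 2) ℂ) :
    embedOp pos (tensorOp A) = tensorOp (Function.extend pos A 1) := by
  ext y x
  have hsplit : ∏ q, Function.extend pos A 1 q (y q) (x q) =
      (∏ k, A k (y (pos k)) (x (pos k))) *
        ∏ q ∈ (Finset.univ.map ⟨pos, hpos⟩)ᶜ, if y q = x q then (1 : ℂ) else 0 := by
    rw [← Finset.prod_mul_prod_compl (Finset.univ.map ⟨pos, hpos⟩), Finset.prod_map]
    congr 1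
    · simp [hpos.extend_apply]
    · refine Finset.prod_congr rfl fun q hq => ?_
      rw [Function.extend_apply' _ _ _ (by simpa using hq)]
      simp [Matrix.one_apply]
  simp only [embedOp, tensorOp, Matrix.of_apply, hsplit, Finset.prod_ite_zero, Function.comp]
  simp

theorem extend_mul_one {pos : K → Q} (hpos : Function.Injective pos)
    (A B : K → Matrix (ZMod 2) (ZMod 2) ℂ) (q : Q) :
    Function.extend pos A 1 q * Function.extend pos B 1 q =
      Function.extend pos (fun k => A k * B k) 1 q := by
  by_cases h : ∃ k, pos k = q
  · obtain ⟨k, rfl⟩ := h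
    simp [hpos.extend_apply]
  · simp [Function.extend_apply' _ _ _ h]

/-- The bit vector on `Q` that carries `a` on the qubits `pos k` and vanishes elsewhere. -/
noncomputable def embedVec (pos : K → Q) (a : K → ZMod 2) : Q → ZMod 2 := Function.extend pos a 0

theorem pauli_embedVec {pos : K → Q} (hpos : Function.Injective pos) (a b : K → ZMod 2) :
    pauli (embedVec pos a) (embedVec pos b) = embedOp pos (pauli a b) := by
  rw [pauli_eq_tensorOp, pauli_eq_tensorOp, embedOp_tensorOp hpos]
  congr 1
  funext q
  by_cases h : ∃ k, pos k = q
  · obtain ⟨k, rfl⟩ := h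
    simp [embedVec, hpos.extend_apply]
  · simp [embedVec, Function.extend_apply' _ _ _ h, pauliFactor_zero]

theorem hadamard_embedVec {pos : K → Q} (hpos : Function.Injective pos) (w : K → ZMod 2) :
    hadamard (embedVec pos w) = embedOp pos (hadamard w) := by
  rw [hadamard_eq_tensorOp, hadamard_eq_tensorOp, embedOp_tensorOp hpos]
  congr 1
  funext q
  by_cases h : ∃ k, pos k = q
  · obtain ⟨k, rfl⟩ := h
    simp [embedVec, hpos.extend_apply]
  · simp [embedVec, Function.extend_apply' _ _ _ h, hadamardFactor_zero]

/-- A commutation rule between a Hadamard circuit and Pauli operators on the qubits `K` holds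
verbatim for their copies on the qubits `pos k`. -/
theorem hadamard_embedVec_mul_pauli {pos : K → Q} (hpos : Function.Injective pos)
    {w a b a' b' : K → ZMod 2} {c : ℂ}
    (h : hadamard w * pauli a b = c • (pauli a' b' * hadamard w)) :
    hadamard (embedVec pos w) * pauli (embedVec pos a) (embedVec pos b) =
      c • (pauli (embedVec pos a') (embedVec pos b') * hadamard (embedVec pos w)) := by
  have key : ∀ A B : K → Matrix (ZMod 2) (ZMod 2) ℂ,
      embedOp pos (tensorOp A) * embedOp pos (tensorOp B) =
        embedOp pos (tensorOp A * tensorOp B) := fun A B => by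
    simp only [embedOp_tensorOp hpos, tensorOp_mul, extend_mul_one hpos]
  simp only [pauli_embedVec hpos, hadamard_embedVec hpos]
  simp only [pauli_eq_tensorOp, hadamard_eq_tensorOp] at h ⊢
  rw [key, key, h, embedOp_smul]

/-- Pauli operators that are trivial on a set of qubits commute with Hadamard gates there. -/
theorem hadamard_mul_pauli_of_disjoint {w u v : Q → ZMod 2}
    (h : ∀ q, w q = 0 ∨ (u q = 0 ∧ v q = 0)) :
    hadamard w * pauli u v = pauli u v * hadamard w := by
  simp only [pauli_eq_tensorOp, hadamard_eq_tensorOp, tensorOp_mul]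
  congr 1
  funext q
  rcases h q with h | ⟨h, h'⟩
  · simp [h, hadamardFactor_zero]
  · simp [h, h', pauliFactor_zero]

end Tensor

/-! ### Layers of CNOT gates and their action on Pauli operators -/

section Matchings

variable {Q : Type} [Fintype Q] [DecidableEq Q]

theorem cnotOp_mul_pauli {c t : Q} (hct : c ≠ t) {u v u' v' : Q → ZMod 2}
    (hu : u' = Function.update u t (u t + u c)) (hv : v' = Function.update v c (v c + v t)) :
    cnotOp c t * pauli u v = pauli u' v' * cnotOp c t := by
  subst hu hv
  ext y x
  simp only [cnotOp, pauli, Matrix.mul_apply, Matrix.of_apply, mul_ite, mul_zero, ite_mul, zero_mul,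
    one_mul, mul_one, Finset.sum_ite_eq', Finset.mem_univ, if_true]
  have hvec : Function.update (x + u) t ((x + u) t + (x + u) c) =
      Function.update x t (x t + x c) + Function.update u t (u t + u c) := by
    funext q
    by_cases hq : q = t
    · subst hq; simp; ring
    · simp [hq]
  have hdot : v ⬝ᵥ x =
      Function.update v c (v c + v t) ⬝ᵥ Function.update x t (x t + x c) := by
    have e1 : Function.update v c (v c + v t) = v + Pi.single c (v t) := by
      funext q
      by_cases hq : q = c
      · subst hq; simp
      · simp [hq]
    have e2 : Function.update x t (x t + x c) = x + Pi.single t (x c) := by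
      funext q
      by_cases hq : q = t
      · subst hq; simp
      · simp [hq]
    rw [e1, e2]
    simp only [add_dotProduct, dotProduct_add, single_dotProduct, dotProduct_single]
    rw [Pi.add_apply, Pi.single_eq_of_ne hct.symm, add_zero, add_assoc,
      CharTwo.add_self_eq_zero, add_zero]
  rw [hvec, hdot]

/-- A set of disjoint ordered pairs of qubits: an involution `partner` of the qubits, and a set of
`controls` whose partners are not controls. It describes the layer of the gates `CNOT` from each
control to its partner. -/
structure Matching (Q : Type) where
  partner : Q → Q
  partner_partner : ∀ q, partner (partner q) = q
  controls : Finset Q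
  partner_notMem : ∀ q ∈ controls, partner q ∉ controls

namespace Matching

variable (m : Matching Q)

theorem ne_partner {q : Q} (hq : q ∈ m.controls) : q ≠ m.partner q :=
  fun h => m.partner_notMem q hq (h ▸ hq)

/-- The layer of `CNOT` gates from the controls to their partners. -/
noncomputable def layer : Layer Q where
  gates := m.controls.attach.toList.map fun q => .cnot q.1 (m.partner q.1) (m.ne_partner q.2)
  disjoint := by
    rw [List.pairwise_map]
    refine List.Pairwise.imp ?_ (Finset.nodup_toList _)
    intro a b hab
    have h1 : (a : Q) ≠ b := fun h => hab (Subtype.ext h)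
    have h2 : (a : Q) ≠ m.partner b := fun h => m.partner_notMem _ b.2 (h ▸ a.2)
    have h3 : m.partner a ≠ b := fun h => m.partner_notMem _ a.2 (h ▸ b.2)
    have h4 : m.partner a ≠ m.partner b := fun h => h1 (by
      rw [← m.partner_partner a, h, m.partner_partner])
    simp [Gate.support, h1.symm, h2.symm, h3.symm, h4.symm]

/-- The action of the layer on the exponents of `X`. -/
def fwd : (Q → ZMod 2) →ₗ[ZMod 2] (Q → ZMod 2) where
  toFun u q := u q + if m.partner q ∈ m.controls then u (m.partner q) else 0
  map_add' u v := by
    funext q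
    by_cases h : m.partner q ∈ m.controls <;> simp [h]; ring
  map_smul' c u := by
    funext q
    by_cases h : m.partner q ∈ m.controls <;> simp [h]; ring

/-- The action of the layer on the exponents of `Z`. -/
def bwd : (Q → ZMod 2) →ₗ[ZMod 2] (Q → ZMod 2) where
  toFun v q := v q + if q ∈ m.controls then v (m.partner q) else 0
  map_add' u v := by
    funext q
    by_cases h : q ∈ m.controls <;> simp [h]; ring
  map_smul' c u := by
    funext q
    by_cases h : q ∈ m.controls <;> simp [h]; ring

theorem fwd_apply (u : Q → ZMod 2) (q : Q) :
    m.fwd u q = u q + if m.partner q ∈ m.controls then u (m.partner q) else 0 := rfl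

theorem bwd_apply (v : Q → ZMod 2) (q : Q) :
    m.bwd v q = v q + if q ∈ m.controls then v (m.partner q) else 0 := rfl

theorem fwd_fwd (u : Q → ZMod 2) : m.fwd (m.fwd u) = u := by
  funext q
  by_cases h : m.partner q ∈ m.controls
  · have h' : q ∉ m.controls := fun hq => m.partner_notMem q hq h
    simp [fwd_apply, h, h', m.partner_partner, add_assoc, CharTwo.add_self_eq_zero]
  · simp [fwd_apply, h]

theorem bwd_bwd (v : Q → ZMod 2) : m.bwd (m.bwd v) = v := by
  funext q
  by_cases h : q ∈ m.controls
  · have h' := m.partner_notMem q h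
    simp [bwd_apply, h, h', add_assoc, CharTwo.add_self_eq_zero]
  · simp [bwd_apply, h]

/-- The actions on the exponents of `X` and of `Z` are contragredient to each other. -/
theorem fwd_dotProduct_bwd (u v : Q → ZMod 2) : m.fwd u ⬝ᵥ m.bwd v = u ⬝ᵥ v := by
  have hre : ∑ q, (if q ∈ m.controls then u q * v (m.partner q) else 0) =
      ∑ q, if m.partner q ∈ m.controls then u (m.partner q) * v q else 0 := by
    have hinv : Function.Involutive m.partner := m.partner_partner
    refine Fintype.sum_equiv hinv.toPerm _ _ fun q => ?_
    simp only [Function.Involutive.coe_toPerm, m.partner_partner]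
  have : ∀ q, m.fwd u q * m.bwd v q = u q * v q +
      ((if q ∈ m.controls then u q * v (m.partner q) else 0) +
        if m.partner q ∈ m.controls then u (m.partner q) * v q else 0) := by
    intro q
    by_cases h : q ∈ m.controls
    · have h' := m.partner_notMem q h
      simp [fwd_apply, bwd_apply, h, h', mul_add]
    · by_cases h' : m.partner q ∈ m.controls <;> simp [fwd_apply, bwd_apply, h, h', add_mul]
  simp only [dotProduct, this, Finset.sum_add_distrib, hre, CharTwo.add_self_eq_zero, add_zero]

theorem layer_op_mul_pauli (u v : Q → ZMod 2) :
    m.layer.op * pauli u v = pauli (m.fwd u) (m.bwd v) * m.layer.op := by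
  -- The gates are added one at a time: `l` lists the controls of the gates already taken.
  have key : ∀ (l : List m.controls), l.Nodup → ∀ u' v' : Q → ZMod 2,
      (∀ q : m.controls, q ∈ l → u' (m.partner q) = u (m.partner q) + u q ∧
        v' q = v q + v (m.partner q)) →
      (∀ q, (∀ c : m.controls, c ∈ l → m.partner c ≠ q) → u' q = u q) →
      (∀ q, (∀ c : m.controls, c ∈ l → (c : Q) ≠ q) → v' q = v q) →
      ((l.map fun q => Gate.cnot q.1 (m.partner q.1) (m.ne_partner q.2)).map Gate.op).prod *
          pauli u v =
        pauli u' v' *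
          ((l.map fun q => Gate.cnot q.1 (m.partner q.1) (m.ne_partner q.2)).map Gate.op).prod := by
    intro l
    induction l with
    | nil =>
      intro _ u' v' _ hu hv
      obtain rfl : u' = u := funext fun q => hu q (by simp)
      obtain rfl : v' = v := funext fun q => hv q (by simp)
      simp
    | cons c l ih =>
      intro hl u' v' hc hu hv
      obtain ⟨hcl, hl⟩ := List.nodup_cons.1 hl
      have hpp : ∀ d : m.controls, m.partner d ≠ c := fun d h =>
        m.partner_notMem _ d.2 (h ▸ c.2)
      have hinj : ∀ d : m.controls, d ∈ l → m.partner d ≠ m.partner c := fun d hd h => hcl (by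
        have : d = c := Subtype.ext (by rw [← m.partner_partner d, h, m.partner_partner])
        exact this ▸ hd)
      have hne : ∀ d : m.controls, d ∈ l → (d : Q) ≠ c := fun d hd h =>
        hcl ((Subtype.ext h : d = c) ▸ hd)
      have step := ih hl (Function.update u' (m.partner c) (u (m.partner c)))
        (Function.update v' c (v c)) (fun d hd => ⟨by
          rw [Function.update_of_ne (hinj d hd)]; exact (hc d (by simp [hd])).1, by
          rw [Function.update_of_ne (hne d hd)]; exact (hc d (by simp [hd])).2⟩)
        (fun q hq => by
          by_cases h : q = m.partner c
          · subst h; simp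
          · rw [Function.update_of_ne h]
            refine hu q fun d hd => ?_
            rcases List.mem_cons.1 hd with rfl | hd
            · exact fun h' => h h'.symm
            · exact hq d hd)
        (fun q hq => by
          by_cases h : q = c
          · subst h; simp
          · rw [Function.update_of_ne h]
            refine hv q fun d hd => ?_
            rcases List.mem_cons.1 hd with rfl | hd
            · exact fun h' => h h'.symm
            · exact hq d hd)
      have hne' : (c : Q) ≠ m.partner c := m.ne_partner c.2
      have huc : u' c = u c := hu c fun d _ => hpp d
      have hvc : v' (m.partner c) = v (m.partner c) := hv _ fun d _ h =>
        m.partner_notMem _ c.2 (h ▸ d.2)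
      have gate := cnotOp_mul_pauli hne'
        (u := Function.update u' (m.partner c) (u (m.partner c)))
        (v := Function.update v' c (v c)) (u' := u') (v' := v')
        (by
          simp only [Function.update_self, Function.update_of_ne hne', Function.update_idem]
          rw [huc, ← (hc c (by simp)).1, Function.update_eq_self])
        (by
          simp only [Function.update_self, Function.update_of_ne hne'.symm, Function.update_idem]
          rw [hvc, ← (hc c (by simp)).2, Function.update_eq_self])
      simp only [List.map_cons, List.prod_cons, Gate.op] at step ⊢
      rw [Matrix.mul_assoc, step, ← Matrix.mul_assoc, gate, Matrix.mul_assoc]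
  refine key _ (Finset.nodup_toList _) _ _ ?_ ?_ ?_
  · intro q _
    simp [fwd_apply, bwd_apply, m.partner_partner]
  · intro q hq
    rw [fwd_apply, if_neg, add_zero]
    exact fun h => hq ⟨_, h⟩ (by simp) (m.partner_partner q)
  · intro q hq
    rw [bwd_apply, if_neg, add_zero]
    exact fun h => hq ⟨q, h⟩ (by simp) rfl

end Matching
end Matchings

/-! ### Hadamard gates conjugated by a decoding circuit -/

section Circuits

variable {Q K : Type} [Fintype Q] [DecidableEq Q] [Fintype K] [DecidableEq K]

theorem Circuit.op_append (C D : Circuit Q) :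
    Circuit.op (C ++ D) = Circuit.op D * Circuit.op C := by
  induction C with
  | nil => simp [Circuit.op]
  | cons L C ih => simp only [List.cons_append, Circuit.op, ih, Matrix.mul_assoc]

theorem Circuit.op_singleton (L : Layer Q) : Circuit.op [L] = L.op := by
  simp [Circuit.op]

namespace Matching

/-- The action on the exponents of `X` of a sequence of layers, the head being applied first. -/
def fwdList : List (Matching Q) → (Q → ZMod 2) →ₗ[ZMod 2] (Q → ZMod 2)
  | [] => LinearMap.id
  | m :: ms => fwdList ms ∘ₗ m.fwd

/-- The action on the exponents of `Z` of a sequence of layers, the head being applied first. -/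
def bwdList : List (Matching Q) → (Q → ZMod 2) →ₗ[ZMod 2] (Q → ZMod 2)
  | [] => LinearMap.id
  | m :: ms => bwdList ms ∘ₗ m.bwd

theorem fwdList_append (ms ms' : List (Matching Q)) (u : Q → ZMod 2) :
    fwdList (ms ++ ms') u = fwdList ms' (fwdList ms u) := by
  induction ms generalizing u with
  | nil => rfl
  | cons m ms ih => exact ih _

theorem bwdList_append (ms ms' : List (Matching Q)) (v : Q → ZMod 2) :
    bwdList (ms ++ ms') v = bwdList ms' (bwdList ms v) := by
  induction ms generalizing v with
  | nil => rfl
  | cons m ms ih => exact ih _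

theorem fwdList_dotProduct_bwdList (ms : List (Matching Q)) (u v : Q → ZMod 2) :
    fwdList ms u ⬝ᵥ bwdList ms v = u ⬝ᵥ v := by
  induction ms generalizing u v with
  | nil => rfl
  | cons m ms ih => exact (ih _ _).trans (m.fwd_dotProduct_bwd u v)

theorem circuit_op_mul_pauli (ms : List (Matching Q)) (u v : Q → ZMod 2) :
    Circuit.op (ms.map layer) * pauli u v =
      pauli (fwdList ms u) (bwdList ms v) * Circuit.op (ms.map layer) := by
  induction ms generalizing u v with
  | nil => simp [Circuit.op, fwdList, bwdList]
  | cons m ms ih =>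
    simp only [List.map_cons, Circuit.op]
    rw [Matrix.mul_assoc, layer_op_mul_pauli, ← Matrix.mul_assoc, ih, Matrix.mul_assoc]
    rfl

/-- The same layers in the reverse order undo the action on the Pauli operators. -/
theorem circuit_reverse_op_mul_pauli (ms : List (Matching Q)) (u v : Q → ZMod 2) :
    Circuit.op (ms.reverse.map layer) * pauli (fwdList ms u) (bwdList ms v) =
      pauli u v * Circuit.op (ms.reverse.map layer) := by
  induction ms generalizing u v with
  | nil => simp [Circuit.op, fwdList, bwdList]
  | cons m ms ih =>
    have h := m.layer_op_mul_pauli (m.fwd u) (m.bwd v)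
    rw [fwd_fwd, bwd_bwd] at h
    rw [List.reverse_cons, List.map_append, List.map_singleton, Circuit.op_append,
      Circuit.op_singleton, Matrix.mul_assoc]
    change m.layer.op * (_ * pauli (fwdList ms (m.fwd u)) (bwdList ms (m.bwd v))) = _
    rw [ih, ← Matrix.mul_assoc, h, Matrix.mul_assoc]

end Matching

/-- The layer of Hadamard gates on the qubits `pos k` with `w k = 1`. -/
noncomputable def hadamardLayer {pos : K → Q} (hpos : Function.Injective pos) (w : K → ZMod 2) :
    Layer Q where
  gates := (Finset.univ.filter fun k => w k = 1).toList.map fun k => .h (pos k)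
  disjoint := by
    rw [List.pairwise_map]
    refine List.Pairwise.imp ?_ (Finset.nodup_toList _)
    intro a b hab
    simpa [Gate.support] using fun h => hab (hpos h)

theorem hadamardLayer_op {pos : K → Q} (hpos : Function.Injective pos) (w : K → ZMod 2) :
    (hadamardLayer hpos w).op = hadamard (embedVec pos w) := by
  have key : ∀ l : List K, l.Nodup →
      ((l.map fun k => Gate.h (pos k)).map Gate.op).prod =
        hadamard (embedVec pos fun k => if k ∈ l then 1 else 0) := by
    intro l
    induction l with
    | nil =>
      intro _
      have : embedVec pos (fun _ => 0) = 0 := by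
        funext q
        by_cases h : ∃ k, pos k = q
        · obtain ⟨k, rfl⟩ := h
          simp [embedVec, hpos.extend_apply]
        · simp [embedVec, Function.extend_apply' _ _ _ h]
      simp [this, hadamard_eq_tensorOp, hadamardFactor_zero, tensorOp_one]
    | cons k l ih =>
      intro hl
      obtain ⟨hkl, hl⟩ := List.nodup_cons.1 hl
      simp only [List.map_cons, List.prod_cons, Gate.op] at ih ⊢
      rw [ih hl, hadamard_mul_hadamard]
      · congr 1
        funext q
        by_cases h : ∃ k, pos k = q
        · obtain ⟨k', rfl⟩ := h
          by_cases hk : k' = k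
          · subst hk
            simp [embedVec, hpos.extend_apply, hkl]
          · simp [embedVec, hpos.extend_apply, hk, hpos.ne hk]
        · have hq : q ≠ pos k := fun hq => h ⟨k, hq.symm⟩
          simp [embedVec, Function.extend_apply' _ _ _ h, hq]
      · intro q
        by_cases hq : q = pos k
        · subst hq
          simp [embedVec, hpos.extend_apply, hkl]
        · simp [hq]
  have hw : ∀ k, (if w k = 1 then 1 else 0) = w k := fun k => by
    generalize w k = t
    revert t
    decide
  refine (key _ (Finset.nodup_toList _)).trans ?_
  simp [hw]

theorem vecMul_eq_embedVec {pos : K → Q} (hpos : Function.Injective pos) (L : Matrix K Q (ZMod 2))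
    (F : (Q → ZMod 2) →ₗ[ZMod 2] (Q → ZMod 2)) (hF : ∀ k, F (L k) = Pi.single (pos k) 1)
    (a : K → ZMod 2) : F (a ᵥ* L) = embedVec pos a := by
  rw [Matrix.vecMul_eq_sum, map_sum]
  simp only [map_smul, hF]
  funext q
  rw [Finset.sum_apply]
  by_cases h : ∃ k, pos k = q
  · obtain ⟨k, rfl⟩ := h
    simp [embedVec, hpos.extend_apply, Pi.single_apply, hpos.eq_iff]
  · have h' : ∀ k, q ≠ pos k := fun k hk => h ⟨k, hk.symm⟩
    simp [embedVec, Function.extend_apply' _ _ _ h, h']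

theorem embedVec_of_forall_ne {pos : K → Q} (a : K → ZMod 2) {q : Q} (h : ∀ k, pos k ≠ q) :
    embedVec pos a q = 0 :=
  Function.extend_apply' _ _ _ (by simpa using h)

/-- If layers of `CNOT` gates turn every logical Pauli operator of `k` into the Pauli operator of
the physical qubit `pos k`, then Hadamard gates on these qubits, conjugated by those layers,
implement the logical Hadamard circuit. The gauge operators commute with the bare logical operators,
so the layers turn them into operators that are trivial on the qubits `pos k`. -/
theorem SubsystemCode.implements_hadamard (𝒞 : SubsystemCode Q K) (ms : List (Matching Q))
    {pos : K → Q} (hpos : Function.Injective pos)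
    (hX : ∀ k, Matching.fwdList ms (𝒞.LX k) = Pi.single (pos k) 1)
    (hZ : ∀ k, Matching.bwdList ms (𝒞.LZ k) = Pi.single (pos k) 1)
    (hGX : ∀ u ∈ 𝒞.gaugeX, ∀ k, u ⬝ᵥ 𝒞.LZ k = 0)
    (hGZ : ∀ v ∈ 𝒞.gaugeZ, ∀ k, 𝒞.LX k ⬝ᵥ v = 0) (w : K → ZMod 2) :
    𝒞.Implements (Circuit.op (ms.map Matching.layer ++ [hadamardLayer hpos w] ++
      ms.reverse.map Matching.layer)) (hadamard w) := by
  rw [Circuit.op_append, Circuit.op_append, Circuit.op_singleton, hadamardLayer_op]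
  set E := Circuit.op (ms.map Matching.layer)
  set E' := Circuit.op (ms.reverse.map Matching.layer)
  set D := hadamard (embedVec pos w)
  have hcomm : ∀ u ∈ 𝒞.gaugeX, ∀ v ∈ 𝒞.gaugeZ,
      E' * (D * E) * pauli u v = pauli u v * (E' * (D * E)) := by
    intro u hu v hv
    have h : D * pauli (Matching.fwdList ms u) (Matching.bwdList ms v) =
        pauli (Matching.fwdList ms u) (Matching.bwdList ms v) * D := by
      refine hadamard_mul_pauli_of_disjoint fun q => ?_
      by_cases hq : ∃ k, pos k = q
      · obtain ⟨k, rfl⟩ := hq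
        right
        have h1 := Matching.fwdList_dotProduct_bwdList ms u (𝒞.LZ k)
        have h2 := Matching.fwdList_dotProduct_bwdList ms (𝒞.LX k) v
        rw [hZ, hGX u hu, dotProduct_single, mul_one] at h1
        rw [hX, hGZ v hv, single_dotProduct, one_mul] at h2
        exact ⟨h1, h2⟩
      · exact Or.inl (embedVec_of_forall_ne w (by simpa using hq))
    rw [Matrix.mul_assoc, Matrix.mul_assoc, Matching.circuit_op_mul_pauli, ← Matrix.mul_assoc D, h,
      Matrix.mul_assoc _ D, ← Matrix.mul_assoc E', Matching.circuit_reverse_op_mul_pauli,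
      Matrix.mul_assoc]
  refine ⟨?_, ?_, ?_⟩
  · rintro x ⟨n, u, hu, v, hv, rfl⟩
    exact ⟨_, ⟨n, u, hu, v, hv, rfl⟩, by rw [mul_smul_comm, hcomm u hu v hv, smul_mul_assoc]⟩
  · rintro ψ ⟨h1, h2⟩
    refine ⟨fun u hu h => ?_, fun v hv h => ?_⟩
    · rw [Matrix.mulVec_mulVec, ← hcomm u hu 0 (zero_mem _), ← Matrix.mulVec_mulVec, h1 u hu h]
    · rw [Matrix.mulVec_mulVec, ← hcomm 0 (zero_mem _) v hv, ← Matrix.mulVec_mulVec, h2 v hv h]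
  · intro a b a' b' c h ψ _
    have hP : ∀ a b, E * 𝒞.logicalPauli a b = pauli (embedVec pos a) (embedVec pos b) * E := by
      intro a b
      rw [SubsystemCode.logicalPauli, Matching.circuit_op_mul_pauli,
        vecMul_eq_embedVec hpos _ _ hX, vecMul_eq_embedVec hpos _ _ hZ]
    have hP' : ∀ a b, E' * pauli (embedVec pos a) (embedVec pos b) = 𝒞.logicalPauli a b * E' := by
      intro a b
      rw [SubsystemCode.logicalPauli, ← Matching.circuit_reverse_op_mul_pauli,
        vecMul_eq_embedVec hpos _ _ hX, vecMul_eq_embedVec hpos _ _ hZ]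
    have hW : E' * (D * E) * 𝒞.logicalPauli a b =
        c • (𝒞.logicalPauli a' b' * (E' * (D * E))) := by
      rw [Matrix.mul_assoc, Matrix.mul_assoc, hP, ← Matrix.mul_assoc D,
        hadamard_embedVec_mul_pauli hpos h, smul_mul_assoc, mul_smul_comm, Matrix.mul_assoc _ D,
        ← Matrix.mul_assoc E', hP', Matrix.mul_assoc]
    rw [Matrix.mulVec_mulVec, hW, Matrix.smul_mulVec, Matrix.mulVec_mulVec]

end Circuits

/-! ### The zeta transform on the nonzero vectors of `𝔽₂ʳ` -/

section Zeta

variable {N : Type} [Fintype N] [DecidableEq N] {r : ℕ}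

/-- A labelling `pt` of the index set `N` by the nonzero vectors of `𝔽₂ʳ`, each used once. -/
structure PointLabelling (N : Type) (r : ℕ) where
  pt : N → Fin r → ZMod 2
  pt_injective : Function.Injective pt
  pt_ne_zero : ∀ q, pt q ≠ 0
  exists_pt : ∀ v : Fin r → ZMod 2, v ≠ 0 → ∃ q, pt q = v

namespace PointLabelling

variable (S : PointLabelling N r)

open Classical in
/-- The point `q + e_s`, where `e_s` is the `s`-th unit vector. The point `e_s`, whose translate is
not a point, is left fixed. -/
noncomputable def shift (s : Fin r) (q : N) : N :=
  if h : S.pt q + Pi.single s 1 = 0 then q else (S.exists_pt _ h).choose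

theorem pt_shift {s : Fin r} {q : N} (h : S.pt q ≠ Pi.single s 1) :
    S.pt (S.shift s q) = S.pt q + Pi.single s 1 := by
  have h' : S.pt q + Pi.single s 1 ≠ 0 := fun h' => h (by
    rwa [add_eq_zero_iff_eq_neg, ZModModule.neg_eq_self] at h')
  rw [shift, dif_neg h']
  exact (S.exists_pt _ h').choose_spec

theorem shift_eq_self {s : Fin r} {q : N} (h : S.pt q = Pi.single s 1) : S.shift s q = q := by
  rw [shift, dif_pos (by rw [h, ZModModule.add_self])]

theorem shift_shift (s : Fin r) (q : N) : S.shift s (S.shift s q) = q := by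
  by_cases h : S.pt q = Pi.single s 1
  · rw [S.shift_eq_self h, S.shift_eq_self h]
  · apply S.pt_injective
    have h' : S.pt (S.shift s q) ≠ Pi.single s 1 := by
      rw [S.pt_shift h]
      simpa using S.pt_ne_zero q
    rw [S.pt_shift h', S.pt_shift h, add_assoc, ZModModule.add_self, add_zero]

theorem eq_zero_or_eq_one (t : ZMod 2) : t = 0 ∨ t = 1 := by
  revert t
  decide

theorem ne_single_of_apply_eq_zero {s : Fin r} {q : N} (h : S.pt q s = 0) :
    S.pt q ≠ Pi.single s 1 := fun h' => by simp [h'] at h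

theorem pt_shift_eq_zero_iff {s : Fin r} {q : N} :
    S.pt (S.shift s q) s = 0 ↔ S.pt q s = 1 ∧ S.pt q ≠ Pi.single s 1 := by
  by_cases h : S.pt q = Pi.single s 1
  · rw [S.shift_eq_self h]
    simp [h]
  · rw [S.pt_shift h]
    simp [h, CharTwo.add_eq_zero]

theorem pt_shift_eq_one_iff {s : Fin r} {q : N} :
    S.pt (S.shift s q) s = 1 ∧ S.pt (S.shift s q) ≠ Pi.single s 1 ↔ S.pt q s = 0 := by
  rw [← S.pt_shift_eq_zero_iff, S.shift_shift]

/-- The layer that adds, in every row of `N × N`, the qubit of `q` to the qubit of `q + e_s`, for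
all points `q` without the coordinate `s`. -/
noncomputable def rowMatching (s : Fin r) : Matching (N × N) where
  partner x := (x.1, S.shift s x.2)
  partner_partner x := by simp [S.shift_shift]
  controls := Finset.univ.filter fun x => S.pt x.2 s = 0
  partner_notMem x hx := by
    have hx : S.pt x.2 s = 0 := by simpa using hx
    simp [S.pt_shift_eq_zero_iff, hx]

/-- The layer that adds, in every column of `N × N`, the qubit of `p + e_s` to the qubit of `p`, for
all points `p` without the coordinate `s`. -/
noncomputable def colMatching (s : Fin r) : Matching (N × N) where
  partner x := (S.shift s x.1, x.2)
  partner_partner x := by simp [S.shift_shift]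
  controls := Finset.univ.filter fun x => S.pt x.1 s = 1 ∧ S.pt x.1 ≠ Pi.single s 1
  partner_notMem x hx := by
    have hx : S.pt x.1 s = 1 ∧ S.pt x.1 ≠ Pi.single s 1 := by simpa using hx
    simp [S.pt_shift_eq_one_iff, hx.1]

/-- The step in the coordinate `s` of the zeta transform `f ↦ (q ↦ ∑_{q' ≤ q} f q')`, where `≤` is
the coordinatewise order on the nonzero vectors. -/
noncomputable def zetaStep (s : Fin r) (f : N → ZMod 2) (q : N) : ZMod 2 :=
  f q + if S.pt q s = 1 ∧ S.pt q ≠ Pi.single s 1 then f (S.shift s q) else 0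

/-- The transpose of `zetaStep`. -/
noncomputable def zetaStepDual (s : Fin r) (f : N → ZMod 2) (q : N) : ZMod 2 :=
  f q + if S.pt q s = 0 then f (S.shift s q) else 0

/-- The bit vector `f ⊗ g` on the grid `N × N`. -/
def gridVec (f g : N → ZMod 2) : N × N → ZMod 2 := fun x => f x.1 * g x.2

theorem rowMatching_fwd (s : Fin r) (f g : N → ZMod 2) :
    (S.rowMatching s).fwd (gridVec f g) = gridVec f (S.zetaStep s g) := by
  funext x
  simp [Matching.fwd_apply, rowMatching, gridVec, zetaStep, S.pt_shift_eq_zero_iff, mul_add]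

theorem rowMatching_bwd (s : Fin r) (f g : N → ZMod 2) :
    (S.rowMatching s).bwd (gridVec f g) = gridVec f (S.zetaStepDual s g) := by
  funext x
  simp [Matching.bwd_apply, rowMatching, gridVec, zetaStepDual, mul_add]

theorem colMatching_fwd (s : Fin r) (f g : N → ZMod 2) :
    (S.colMatching s).fwd (gridVec f g) = gridVec (S.zetaStepDual s f) g := by
  funext x
  simp [Matching.fwd_apply, colMatching, gridVec, zetaStepDual, S.pt_shift_eq_one_iff, add_mul]

theorem colMatching_bwd (s : Fin r) (f g : N → ZMod 2) :
    (S.colMatching s).bwd (gridVec f g) = gridVec (S.zetaStep s f) g := by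
  funext x
  simp [Matching.bwd_apply, colMatching, gridVec, zetaStep, add_mul]

theorem zetaStepDual_single {j : Fin r} {q₀ : N} (hq₀ : S.pt q₀ = Pi.single j 1) (s : Fin r) :
    S.zetaStepDual s (Pi.single q₀ 1) = Pi.single q₀ 1 := by
  funext q
  rw [zetaStepDual]
  by_cases h : S.pt q s = 0
  · have hne : S.shift s q ≠ q₀ := by
      intro h'
      have h1 := S.pt_shift (S.ne_single_of_apply_eq_zero h)
      rw [h', hq₀] at h1
      have hjs : j = s := by
        by_contra hjs
        have := congrFun h1 s
        simp [h, Ne.symm hjs] at this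
      subst hjs
      exact S.pt_ne_zero q (by simpa using h1)
    simp [hne]
  · simp [h]

/-- The restriction of the `j`-th coordinate to the points that vanish in all coordinates of `T`
other than `j`. -/
def truncCoord (j : Fin r) (T : Finset (Fin r)) (q : N) : ZMod 2 :=
  if S.pt q j = 1 ∧ ∀ s ∈ T, s ≠ j → S.pt q s = 0 then 1 else 0

theorem truncCoord_empty (j : Fin r) : S.truncCoord j ∅ = fun q => S.pt q j := by
  funext q
  rcases eq_zero_or_eq_one (S.pt q j) with h | h <;> simp [truncCoord, h]

theorem truncCoord_univ {j : Fin r} {q₀ : N} (hq₀ : S.pt q₀ = Pi.single j 1) :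
    S.truncCoord j Finset.univ = Pi.single q₀ 1 := by
  funext q
  rw [truncCoord, Pi.single_apply]
  congr 1
  rw [eq_iff_iff]
  constructor
  · rintro ⟨h1, h2⟩
    apply S.pt_injective
    funext s
    by_cases hs : s = j
    · subst hs; simp [h1, hq₀]
    · simp [h2 s (Finset.mem_univ s) hs, hq₀, hs]
  · rintro rfl
    simp +contextual [hq₀]

/-- A step of the zeta transform cancels the part of a truncated coordinate on the points that
contain the coordinate `s`. -/
theorem zetaStep_truncCoord (j s : Fin r) (T : Finset (Fin r)) (hs : s ∉ T) :
    S.zetaStep s (S.truncCoord j T) = S.truncCoord j (insert s T) := by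
  funext q
  rw [zetaStep]
  by_cases hq : S.pt q s = 1 ∧ S.pt q ≠ Pi.single s 1
  · rw [if_pos hq]
    have hsh := S.pt_shift hq.2
    by_cases hsj : s = j
    · subst hsj
      have h0 : S.truncCoord s T (S.shift s q) = 0 := by
        simp [truncCoord, S.pt_shift_eq_zero_iff.2 hq]
      rw [h0, add_zero]
      simp [truncCoord]
    · have h1 : S.truncCoord j T (S.shift s q) = S.truncCoord j T q := by
        have hc : ∀ t, t ≠ s → S.pt (S.shift s q) t = S.pt q t := fun t ht => by
          simp [hsh, ht]
        have hT : (∀ t ∈ T, t ≠ j → S.pt (S.shift s q) t = 0) ↔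
            ∀ t ∈ T, t ≠ j → S.pt q t = 0 :=
          forall₂_congr fun t ht => by rw [hc t (fun h => hs (h ▸ ht))]
        simp only [truncCoord, hc j (Ne.symm hsj), hT]
      rw [h1, CharTwo.add_self_eq_zero]
      simp [truncCoord, hq.1, hsj]
  · rw [if_neg hq, add_zero]
    simp only [truncCoord]
    congr 1
    rw [eq_iff_iff]
    refine and_congr_right fun hj => ?_
    simp only [Finset.forall_mem_insert, iff_and_self]
    intro _ hsj
    rcases eq_zero_or_eq_one (S.pt q s) with h | h
    · exact h
    · refine absurd ⟨h, fun h' => ?_⟩ hq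
      simp [h', Ne.symm hsj] at hj

theorem fwdList_rowMatching (f : N → ZMod 2) (j : Fin r) (l : List (Fin r)) (hl : l.Nodup)
    (T : Finset (Fin r)) (hT : ∀ s ∈ l, s ∉ T) :
    Matching.fwdList (l.map S.rowMatching) (gridVec f (S.truncCoord j T)) =
      gridVec f (S.truncCoord j (l.toFinset ∪ T)) := by
  induction l generalizing T with
  | nil => simp [Matching.fwdList]
  | cons s l ih =>
    obtain ⟨hsl, hl⟩ := List.nodup_cons.1 hl
    rw [List.map_cons]
    change Matching.fwdList _ ((S.rowMatching s).fwd _) = _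
    rw [rowMatching_fwd, zetaStep_truncCoord _ _ _ _ (hT s (by simp)), ih hl]
    · congr 2
      simp [Finset.union_insert]
    · intro t ht
      rw [Finset.mem_insert, not_or]
      exact ⟨fun h => hsl (h ▸ ht), hT t (by simp [ht])⟩

theorem bwdList_colMatching (g : N → ZMod 2) (j : Fin r) (l : List (Fin r)) (hl : l.Nodup)
    (T : Finset (Fin r)) (hT : ∀ s ∈ l, s ∉ T) :
    Matching.bwdList (l.map S.colMatching) (gridVec (S.truncCoord j T) g) =
      gridVec (S.truncCoord j (l.toFinset ∪ T)) g := by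
  induction l generalizing T with
  | nil => simp [Matching.bwdList]
  | cons s l ih =>
    obtain ⟨hsl, hl⟩ := List.nodup_cons.1 hl
    rw [List.map_cons]
    change Matching.bwdList _ ((S.colMatching s).bwd _) = _
    rw [colMatching_bwd, zetaStep_truncCoord _ _ _ _ (hT s (by simp)), ih hl]
    · congr 2
      simp [Finset.union_insert]
    · intro t ht
      rw [Finset.mem_insert, not_or]
      exact ⟨fun h => hsl (h ▸ ht), hT t (by simp [ht])⟩

theorem fwdList_colMatching (g : N → ZMod 2) {i : Fin r} {q₀ : N} (hq₀ : S.pt q₀ = Pi.single i 1)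
    (l : List (Fin r)) :
    Matching.fwdList (l.map S.colMatching) (gridVec (Pi.single q₀ 1) g) =
      gridVec (Pi.single q₀ 1) g := by
  induction l with
  | nil => rfl
  | cons s l ih =>
    rw [List.map_cons]
    change Matching.fwdList _ ((S.colMatching s).fwd _) = _
    rw [colMatching_fwd, S.zetaStepDual_single hq₀, ih]

theorem bwdList_rowMatching (f : N → ZMod 2) {i : Fin r} {q₀ : N} (hq₀ : S.pt q₀ = Pi.single i 1)
    (l : List (Fin r)) :
    Matching.bwdList (l.map S.rowMatching) (gridVec f (Pi.single q₀ 1)) =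
      gridVec f (Pi.single q₀ 1) := by
  induction l with
  | nil => rfl
  | cons s l ih =>
    rw [List.map_cons]
    change Matching.bwdList _ ((S.rowMatching s).bwd _) = _
    rw [rowMatching_bwd, S.zetaStepDual_single hq₀, ih]

/-- The layers of the zeta transform along the rows, then of its contragredient along the columns. -/
noncomputable def decoder : List (Matching (N × N)) :=
  (List.finRange r).map S.rowMatching ++ (List.finRange r).map S.colMatching

theorem gridVec_single (p q : N) :
    gridVec (Pi.single p 1) (Pi.single q 1) = Pi.single (p, q) 1 := by
  funext x
  simp only [gridVec, Pi.single_apply, Prod.ext_iff, mul_ite, mul_one, mul_zero]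
  by_cases h1 : x.1 = p <;> by_cases h2 : x.2 = q <;> simp [h1, h2]

theorem fwdList_decoder {i j : Fin r} {p q : N} (hp : S.pt p = Pi.single i 1)
    (hq : S.pt q = Pi.single j 1) :
    Matching.fwdList S.decoder (gridVec (Pi.single p 1) fun x => S.pt x j) =
      Pi.single (p, q) 1 := by
  have huniv : (List.finRange r).toFinset = Finset.univ := by ext; simp
  rw [decoder, Matching.fwdList_append, ← truncCoord_empty,
    S.fwdList_rowMatching _ _ _ (List.nodup_finRange r) _ (by simp), Finset.union_empty, huniv,
    S.truncCoord_univ hq, S.fwdList_colMatching _ hp, gridVec_single]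

theorem bwdList_decoder {i j : Fin r} {p q : N} (hp : S.pt p = Pi.single i 1)
    (hq : S.pt q = Pi.single j 1) :
    Matching.bwdList S.decoder (gridVec (fun x => S.pt x i) (Pi.single q 1)) =
      Pi.single (p, q) 1 := by
  have huniv : (List.finRange r).toFinset = Finset.univ := by ext; simp
  rw [decoder, Matching.bwdList_append, ← truncCoord_empty, S.bwdList_rowMatching _ hq,
    S.bwdList_colMatching _ _ _ (List.nodup_finRange r) _ (by simp), Finset.union_empty, huniv,
    S.truncCoord_univ hp, gridVec_single]

end PointLabelling
end Zeta

/-! ### The simplex code -/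

section Simplex

variable {r a b : ℕ}

/-- For a root `α` of `h` with `α ^ n = 1` and a linear functional `φ`, the word `(φ (α ^ j))_j`
satisfies the parity checks `x ^ i h`. -/
theorem parityCheck_mulVec_eq_zero {F : Type*} [Field F] [Algebra (ZMod 2) F] (hr : 0 < len r)
    (hab : a < b) (hb : b < len r) {α : F} (hα : Polynomial.aeval α (trinomial a b) = 0)
    (hn : α ^ len r = 1) (φ : Module.Dual (ZMod 2) F) :
    parityCheck r a b *ᵥ (fun j => φ (α ^ j.val)) = 0 := by
  have : NeZero (len r) := ⟨hr.ne'⟩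
  have hdeg : (trinomial a b).natDegree < len r := by
    refine lt_of_le_of_lt ?_ hb
    unfold trinomial
    compute_degree
    omega
  funext i
  have hpow : ∀ k : Fin (len r), α ^ (k + i).val = α ^ i.val * α ^ k.val := by
    intro k
    rw [Fin.val_add, ← pow_add, add_comm i.val, ← pow_mod_orderOf,
      Nat.mod_mod_of_dvd _ (orderOf_dvd_of_pow_eq_one hn), pow_mod_orderOf]
  have h1 : (parityCheck r a b *ᵥ fun j => φ (α ^ j.val)) i =
      ∑ k : Fin (len r), (trinomial a b).coeff k.val * φ (α ^ (k + i).val) := by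
    simp only [Matrix.mulVec, dotProduct, parityCheck, Matrix.of_apply]
    refine (Fintype.sum_equiv (Equiv.addRight i) _ _ fun k => ?_).symm
    simp
  have h2 : Polynomial.aeval α (trinomial a b) =
      ∑ k : Fin (len r), (trinomial a b).coeff k.val • α ^ k.val := by
    rw [Polynomial.aeval_eq_sum_range' hdeg, Finset.sum_range]
  rw [h1, Pi.zero_apply]
  calc ∑ k : Fin (len r), (trinomial a b).coeff k.val * φ (α ^ (k + i).val)
      = φ (α ^ i.val * ∑ k : Fin (len r), (trinomial a b).coeff k.val • α ^ k.val) := by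
        rw [Finset.mul_sum, map_sum]
        refine Finset.sum_congr rfl fun k _ => ?_
        rw [hpow, mul_smul_comm, map_smul, smul_eq_mul]
    _ = 0 := by rw [← h2, hα, mul_zero, map_zero]

/-- The words of the simplex code separate the positions, and no position vanishes on all of them:
a root `α` of the primitive factor of `h` has pairwise distinct nonzero powers `α ^ j`, `j < n`. -/
theorem exists_codeword_separating (hr : 0 < len r) (h : IsCheckTrinomial r a b) :
    (∀ j, ∃ c ∈ LinearMap.ker (parityCheck r a b).mulVecLin, c j ≠ 0) ∧
    ∀ j j', j ≠ j' → ∃ c ∈ LinearMap.ker (parityCheck r a b).mulVecLin, c j ≠ c j' := by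
  classical
  obtain ⟨-, hab, hb, hirr, -, hord⟩ := h
  set p := EuclideanDomain.gcd (trinomial a b) (Polynomial.X ^ len r - 1)
  have : Fact (Irreducible p) := ⟨hirr⟩
  set α := AdjoinRoot.root p
  have hα : Polynomial.aeval α (trinomial a b) = 0 := by
    rw [AdjoinRoot.aeval_eq, AdjoinRoot.mk_eq_zero]
    exact EuclideanDomain.gcd_dvd_left _ _
  have hn : α ^ len r = 1 := orderOf_dvd_iff_pow_eq_one.1 (dvd_of_eq hord)
  have hα0 : α ≠ 0 := by
    intro h0
    rw [h0, zero_pow hr.ne'] at hn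
    exact zero_ne_one hn
  have hmem : ∀ φ : Module.Dual (ZMod 2) (AdjoinRoot p),
      (fun j : Fin (len r) => φ (α ^ j.val)) ∈ LinearMap.ker (parityCheck r a b).mulVecLin :=
    fun φ => parityCheck_mulVec_eq_zero hr hab hb hα hn φ
  have hsep : ∀ x : AdjoinRoot p, x ≠ 0 → ∃ φ : Module.Dual (ZMod 2) (AdjoinRoot p), φ x ≠ 0 := by
    intro x hx
    by_contra! hφ
    exact hx ((Module.forall_dual_apply_eq_zero_iff (ZMod 2) x).1 hφ)
  refine ⟨fun j => ?_, fun j j' hjj' => ?_⟩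
  · obtain ⟨φ, hφ⟩ := hsep (α ^ j.val) (pow_ne_zero _ hα0)
    exact ⟨_, hmem φ, hφ⟩
  · obtain ⟨φ, hφ⟩ := hsep (α ^ j.val - α ^ j'.val) (sub_ne_zero.2 fun heq => hjj' (Fin.ext
      (pow_injOn_Iio_orderOf (hord ▸ j.2 : j.val < orderOf α)
        (hord ▸ j'.2 : j'.val < orderOf α) heq)))
    exact ⟨_, hmem φ, fun heq => hφ (by rw [map_sub, sub_eq_zero]; exact heq)⟩

variable {H : Matrix (Fin (len r)) (Fin (len r)) (ZMod 2)}
  {G : Matrix (Fin r) (Fin (len r)) (ZMod 2)} {π : Fin r → Fin (len r)}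

/-- A codeword, being a combination of the rows of `G`, takes equal values at equal columns of `G`
and vanishes at zero columns. -/
theorem IsPivotedGenerator.exists_coeff (hG : IsPivotedGenerator H G π) {c : Fin (len r) → ZMod 2}
    (hc : c ∈ LinearMap.ker H.mulVecLin) :
    ∃ x : Fin r → ZMod 2, ∀ q, c q = x ⬝ᵥ G.col q := by
  rw [← hG.span_rows, Submodule.mem_span_range_iff_exists_fun] at hc
  obtain ⟨x, rfl⟩ := hc
  exact ⟨x, fun q => by simp [dotProduct, Matrix.row, Matrix.col]⟩

theorem IsPivotedGenerator.col_pivot (hG : IsPivotedGenerator H G π) (i : Fin r) :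
    G.col (π i) = Pi.single i 1 := by
  funext j
  have h := congrFun (congrFun hG.pivots i) j
  simpa [Matrix.mul_apply, pivotMatrix, Matrix.one_apply, Pi.single_apply, eq_comm] using h

/-- The columns of a generator matrix of the simplex code are the nonzero vectors of `𝔽₂ʳ`, each
occurring once. -/
def IsPivotedGenerator.labelling (hr : 0 < len r) (h : IsCheckTrinomial r a b)
    (hG : IsPivotedGenerator (parityCheck r a b) G π) : PointLabelling (Fin (len r)) r :=
  have hinj : Function.Injective G.col := by
    intro q q' hqq'
    by_contra hne
    obtain ⟨c, hc, hcq⟩ := (exists_codeword_separating hr h).2 q q' hne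
    obtain ⟨x, hx⟩ := hG.exists_coeff hc
    exact hcq (by rw [hx, hx, hqq'])
  have hne : ∀ q, G.col q ≠ 0 := by
    intro q hq
    obtain ⟨c, hc, hcq⟩ := (exists_codeword_separating hr h).1 q
    obtain ⟨x, hx⟩ := hG.exists_coeff hc
    exact hcq (by rw [hx, hq, dotProduct_zero])
  { pt := G.col
    pt_injective := hinj
    pt_ne_zero := hne
    exists_pt := by
      -- There are as many columns as nonzero vectors, so injectivity suffices.
      have hcard : Fintype.card (Fin (len r)) =
          Fintype.card {v : Fin r → ZMod 2 // v ≠ 0} := by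
        rw [Fintype.card_subtype_compl]
        simp [ZMod.card]
      have hbij : Function.Bijective fun q => (⟨G.col q, hne q⟩ : {v : Fin r → ZMod 2 // v ≠ 0}) :=
        (Fintype.bijective_iff_injective_and_card _).2
          ⟨fun q q' hqq' => hinj (congrArg Subtype.val hqq'), hcard⟩
      intro v hv
      obtain ⟨q, hq⟩ := hbij.2 ⟨v, hv⟩
      exact ⟨q, congrArg Subtype.val hq⟩ }

theorem IsPivotedGenerator.mul_transpose (hG : IsPivotedGenerator H G π) : H * Gᵀ = 0 := by
  ext i j
  have hj : G.row j ∈ LinearMap.ker H.mulVecLin :=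
    hG.span_rows ▸ Submodule.subset_span ⟨j, rfl⟩
  exact congrFun hj i

theorem pivotMatrix_apply_eq_single (i : Fin r) : pivotMatrix π i = Pi.single (π i) 1 := by
  funext q
  simp [pivotMatrix, Pi.single_apply, eq_comm]

theorem dotProduct_eq_zero_of_mem_span {Q ι : Type} [Fintype Q] {A : Matrix ι Q (ZMod 2)}
    {w u : Q → ZMod 2} (h : ∀ i, A i ⬝ᵥ w = 0)
    (hu : u ∈ Submodule.span (ZMod 2) (Set.range A.row)) : u ⬝ᵥ w = 0 := by
  induction hu using Submodule.span_induction with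
  | mem x hx =>
    obtain ⟨i, rfl⟩ := hx
    exact h i
  | zero => exact zero_dotProduct w
  | add x y _ _ hx hy => rw [add_dotProduct, hx, hy, add_zero]
  | smul c x _ hx => rw [smul_dotProduct, hx, smul_zero]

theorem shyps_gaugeX_dotProduct (hG : IsPivotedGenerator H G π)
    (u : Fin (len r) × Fin (len r) → ZMod 2) (hu : u ∈ (shyps H G π).gaugeX) (k : Fin r × Fin r) :
    u ⬝ᵥ (shyps H G π).LZ k = 0 := by
  refine dotProduct_eq_zero_of_mem_span (fun i => ?_) hu
  have h : (H ⊗ₖ (1 : Matrix (Fin (len r)) (Fin (len r)) (ZMod 2))) *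
      (G ⊗ₖ pivotMatrix π)ᵀ = 0 := by
    rw [← Matrix.kroneckerMap_transpose, ← Matrix.mul_kronecker_mul, hG.mul_transpose,
      Matrix.zero_kronecker]
  exact congrFun (congrFun h i) k

theorem shyps_gaugeZ_dotProduct (hG : IsPivotedGenerator H G π)
    (v : Fin (len r) × Fin (len r) → ZMod 2) (hv : v ∈ (shyps H G π).gaugeZ) (k : Fin r × Fin r) :
    (shyps H G π).LX k ⬝ᵥ v = 0 := by
  rw [dotProduct_comm]
  refine dotProduct_eq_zero_of_mem_span (fun i => ?_) hv
  have h : ((1 : Matrix (Fin (len r)) (Fin (len r)) (ZMod 2)) ⊗ₖ H) *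
      (pivotMatrix π ⊗ₖ G)ᵀ = 0 := by
    rw [← Matrix.kroneckerMap_transpose, ← Matrix.mul_kronecker_mul, hG.mul_transpose,
      Matrix.kronecker_zero]
  exact congrFun (congrFun h i) k

theorem shyps_LX (k : Fin r × Fin r) :
    (shyps H G π).LX k =
      PointLabelling.gridVec (Pi.single (π k.1) 1) fun q => G.col q k.2 := by
  funext x
  change pivotMatrix π k.1 x.1 * G k.2 x.2 = _
  rw [pivotMatrix_apply_eq_single]
  rfl

theorem shyps_LZ (k : Fin r × Fin r) :
    (shyps H G π).LZ k =
      PointLabelling.gridVec (fun p => G.col p k.1) (Pi.single (π k.2) 1) := by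
  funext x
  change G k.1 x.1 * pivotMatrix π k.2 x.2 = _
  rw [pivotMatrix_apply_eq_single]
  rfl

theorem IsPivotedGenerator.pivot_injective (hG : IsPivotedGenerator H G π) :
    Function.Injective π := by
  intro i i' h
  have h' := hG.col_pivot i
  rw [h, hG.col_pivot i'] at h'
  by_contra hne
  have := congrFun h' i
  simp [hne] at this

end Simplex

end SHYPS

theorem mainTheorem12 (r : ℕ) (hr : 3 ≤ r) (a b : ℕ) (hab : SHYPS.IsCheckTrinomial r a b)
    (G : Matrix (Fin r) (Fin (SHYPS.len r)) (ZMod 2)) (π : Fin r → Fin (SHYPS.len r))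
    (hG : SHYPS.IsPivotedGenerator (SHYPS.parityCheck r a b) G π)
    (V : Matrix (Fin r) (Fin r) (ZMod 2)) :
    ∃ (C : SHYPS.Circuit (Fin (SHYPS.len r) × Fin (SHYPS.len r)))
      (α β : Fin r × Fin r → ZMod 2),
      SHYPS.Circuit.depth C ≤ 11 * r + 15 ∧
      (SHYPS.shyps (SHYPS.parityCheck r a b) G π).Implements
        ((SHYPS.shyps (SHYPS.parityCheck r a b) G π).logicalPauli α β * SHYPS.Circuit.op C)
        (SHYPS.hadamard fun q => V q.1 q.2) := by
  have hlen : 0 < SHYPS.len r := by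
    have : 2 ^ 1 ≤ 2 ^ r := Nat.pow_le_pow_right (by norm_num) (by omega)
    simp only [SHYPS.len]
    omega
  let S := hG.labelling hlen hab
  let pos : Fin r × Fin r → Fin (SHYPS.len r) × Fin (SHYPS.len r) := Prod.map π π
  have hpos : Function.Injective pos := hG.pivot_injective.prodMap hG.pivot_injective
  refine ⟨S.decoder.map SHYPS.Matching.layer ++
    [SHYPS.hadamardLayer hpos fun q => V q.1 q.2] ++
      S.decoder.reverse.map SHYPS.Matching.layer, 0, 0, ?_, ?_⟩
  · simp [SHYPS.Circuit.depth, SHYPS.PointLabelling.decoder]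
    omega
  · have h1 : (SHYPS.shyps (SHYPS.parityCheck r a b) G π).logicalPauli 0 0 = 1 := by
      simp [SHYPS.SubsystemCode.logicalPauli, SHYPS.pauli_zero]
    rw [h1, Matrix.one_mul]
    refine SHYPS.SubsystemCode.implements_hadamard _ S.decoder hpos (fun k => ?_) (fun k => ?_)
      (SHYPS.shyps_gaugeX_dotProduct hG) (SHYPS.shyps_gaugeZ_dotProduct hG) _
    · rw [SHYPS.shyps_LX]
      exact S.fwdList_decoder (hG.col_pivot k.1) (hG.col_pivot k.2)
    · rw [SHYPS.shyps_LZ]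
      exact S.bwdList_decoder (hG.col_pivot k.1) (hG.col_pivot k.2)
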